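/- Let $\rho$ be a prime with $\rho\equiv\pm5\pmod{12}$ such that $3$ has multiplicative order $\rho-1$ modulo $\rho$. Put $m=\rho-1$, let $\alpha$ be a primitive element of $\mathrm{GF}(3^m)$, and set $\beta=\alpha^{(3^m-1)/(4\rho)}$, a primitive $4\rho$-th root of unity, and $\theta=\beta^{-1}$. Let $\mathcal C(\rho)$ be the ternary negacyclic code of length $2\rho$ whose check polynomial is the minimal polynomial $\mathbb M_\beta(x)$ of $\beta$ over $\mathrm{GF}(3)$; that is, identifying $(c_0,\dots,c_{2\rho-1})\in\mathrm{GF}(3)^{2\rho}$ with $\sum_i c_ix^i\in\mathrm{GF}(3)[x]/(x^{2\rho}+1)$, the code $\mathcal C(\rho)$ is the ideal generated by $(x^{2\rho}+1)/\mathbb M_\beta(x)$. Let $$\overline{\mathcal C}(\rho)=\left\{\left(\mathrm{Tr}_{3^m/3^2}(a\,\theta^{2i})\right)_{i=0}^{\rho-1}:\ a\in\mathrm{GF}(3^m)\right\}\subseteq \mathrm{GF}(3^2)^{\rho},$$ where $\mathrm{Tr}_{3^m/3^2}$ is the trace from $\mathrm{GF}(3^m)$ to $\mathrm{GF}(3^2)$.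 For a linear code $\mathcal C\subseteq \mathrm{GF}(q)^n$, write $\mathcal C^\perp=\{c\in \mathrm{GF}(q)^n:\sum_i c_ib_i=0\ \text{for all } b\in\mathcal C\}$ for its dual and $d(\mathcal C)$ for its minimum Hamming distance. Then $\mathcal C(\rho)^\perp$ is a ternary negacyclic code (it is closed under $(c_0,\dots,c_{2\rho-1})\mapsto(-c_{2\rho-1},c_0,\dots,c_{2\rho-2})$) with parameters $[2\rho,\rho+1,d^\perp]$, i.e. its length is $2\rho$, its dimension over $\mathrm{GF}(3)$ is $\rho+1$ and its minimum distance is $d^\perp$, where $$d^\perp\ \ge\ d\left(\overline{\mathcal C}(\rho)^\perp\right)\ \ge\ \sqrt{\rho}.$$ -/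

import Mathlib

open Polynomial

namespace NegacyclicCode

noncomputable section

/-- The `lam`-constacyclic shift
`(c_0, c_1, …, c_{n-1}) ↦ (lam * c_{n-1}, c_0, …, c_{n-2})`. -/
def constacyclicShift {F : Type*} [Field F] {n : ℕ} (lam : F) (c : Fin n → F) : Fin n → F :=
  fun i => if (i : ℕ) = 0 then lam * c ⟨n - 1, by have := i.isLt; omega⟩
    else c ⟨(i : ℕ) - 1, by have := i.isLt; omega⟩

/-- A linear code of length `n` is `lam`-constacyclic if it is stable under the
`lam`-constacyclic shift. -/
def IsConstacyclic {F : Type*} [Field F] {n : ℕ} (lam : F) (C : Submodule F (Fin n → F)) : Prop :=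
  ∀ c ∈ C, constacyclicShift lam c ∈ C

/-- A negacyclic code is a `(-1)`-constacyclic code. -/
def IsNegacyclic {F : Type*} [Field F] {n : ℕ} (C : Submodule F (Fin n → F)) : Prop :=
  IsConstacyclic (-1) C

/-- The map `(c_0, …, c_{n-1}) ↦ c_0 + c_1 x + ⋯ + c_{n-1} x^{n-1}` from `F ^ n` to
`F[x] / (x ^ n + 1)`. -/
def toQuotient (F : Type*) [Field F] (n : ℕ) :
    (Fin n → F) →ₗ[F] AdjoinRoot (X ^ n + 1 : F[X]) :=
  Fintype.linearCombination F fun i : Fin n => AdjoinRoot.root (X ^ n + 1 : F[X]) ^ (i : ℕ)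

/-- The negacyclic code of length `n` over `F` with check polynomial `h` (a divisor of
`x ^ n + 1`): the words that correspond to the ideal of `F[x] / (x ^ n + 1)` generated by
the generator polynomial `(x ^ n + 1) / h`. -/
def codeOfCheckPoly {F : Type*} [Field F] (n : ℕ) (h : F[X]) : Submodule F (Fin n → F) :=
  ((Ideal.span {AdjoinRoot.mk (X ^ n + 1 : F[X]) ((X ^ n + 1) / h)}).restrictScalars F).comap
    (toQuotient F n)

/-- The dual code, with respect to the standard bilinear form `∑ i, c i * b i`. -/
def dualCode {F : Type*} [Field F] {n : ℕ} (C : Submodule F (Fin n → F)) :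
    Submodule F (Fin n → F) where
  carrier := {c | ∀ b ∈ C, ∑ i, c i * b i = 0}
  add_mem' := by
    intro x y hx hy b hb
    simp only [Pi.add_apply, add_mul, Finset.sum_add_distrib]
    rw [hx b hb, hy b hb, add_zero]
  zero_mem' := by
    intro b _
    simp
  smul_mem' := by
    intro r x hx b hb
    simp only [Pi.smul_apply, smul_eq_mul, mul_assoc]
    rw [← Finset.mul_sum, hx b hb, mul_zero]

open Classical in
/-- The minimum Hamming distance between distinct codewords (it is `0` only for the zero code,
which has no two distinct codewords). -/
def minDist {F : Type*} [Field F] {n : ℕ} (C : Submodule F (Fin n → F)) : ℕ :=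
  sInf {d | ∃ x ∈ C, ∃ y ∈ C, x ≠ y ∧ hammingDist x y = d}

/-- For an extension `K / E` of fields and `θ ∈ K`, the code
`{ (Tr_{K/E}(a θ^{2i}))_{0 ≤ i < n} : a ∈ K }` over `E`. -/
def traceCode (E : Type*) {K : Type*} [Field E] [Field K] [Algebra E K] (n : ℕ) (θ : K) :
    Submodule E (Fin n → E) :=
  LinearMap.range (LinearMap.pi fun i : Fin n =>
    Algebra.trace E K ∘ₗ LinearMap.mulRight E (θ ^ (2 * (i : ℕ))))

theorem mem_traceCode {E K : Type*} [Field E] [Field K] [Algebra E K] {n : ℕ} {θ : K}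
    {c : Fin n → E} :
    c ∈ traceCode E n θ ↔
      ∃ a : K, c = fun i : Fin n => Algebra.trace E K (a * θ ^ (2 * (i : ℕ))) := by
  constructor
  · rintro ⟨a, rfl⟩
    exact ⟨a, rfl⟩
  · rintro ⟨a, rfl⟩
    exact ⟨a, rfl⟩

/-- The element `β = α ^ ((3 ^ (ρ - 1) - 1) / (4 ρ))`. -/
def beta {K : Type*} [Field K] (ρ : ℕ) (α : K) : K :=
  α ^ ((3 ^ (ρ - 1) - 1) / (4 * ρ))

/-- The code `𝒞(ρ)`: the ternary negacyclic code of length `2 ρ` whose check polynomial is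
the minimal polynomial of `β` over `GF(3)`. -/
def ternaryCode {K : Type*} [Field K] [Algebra (ZMod 3) K] (ρ : ℕ) (α : K) :
    Submodule (ZMod 3) (Fin (2 * ρ) → ZMod 3) :=
  codeOfCheckPoly (2 * ρ) (minpoly (ZMod 3) (beta ρ α))

/-- The associated code of length `ρ` over `GF(9) = E`, given by its trace representation with
`θ = β⁻¹`. -/
def nonaryCode (E : Type*) {K : Type*} [Field E] [Field K] [Algebra E K] (ρ : ℕ) (α : K) :
    Submodule E (Fin ρ → E) :=
  traceCode E ρ (beta ρ α)⁻¹

end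

end NegacyclicCode

namespace NegacyclicCode

/-! Both duals are described by one zero. A ternary word lies in the dual of `ternaryCode` iff its
polynomial vanishes at `θ = β⁻¹`; a word over GF(9) lies in the dual of `nonaryCode` iff its
polynomial vanishes at `θ ^ 2`. The first description gives closure under the negacyclic shift. It
also gives the dimension, since `θ` has degree `ρ - 1` over GF(3).

For the comparison of distances, `θ ^ ρ` is a square root `u` of `-1` and lies in GF(9). Pairing
position `2j` with the one at distance `ρ` turns a ternary word `c` into the word with entries
`c_{2j} ± u c_{2j±ρ}` over GF(9). As `1, u` are independent over GF(3), no nonzero pair is lost and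
the weight cannot grow (`exists_weight_le_of_vanishing`).

For the square root bound, `δ = -θ ^ 2` is a primitive `ρ`-th root of unity. Twisting the entries by
`(-1)^i` gives a cyclic word vanishing at `δ`, hence at every `δ ^ (9 ^ a)`. Since 3 is a primitive
root modulo `ρ`, the powers of 9 are all the nonzero squares, so the word lies in a quadratic
residue code (`le_weight_sq_of_vanishing`). The classical bound handles words with nonzero
coordinate sum; the others are first moved to such a word by an inversion of Gleason–Prange type
(`card_le_sq_of_fourierSum_eq_zero`). -/

theorem mulChar_ne_zero {F K : Type*} [Field F] [Field K] (χ : MulChar F K) {k : F} (hk : k ≠ 0) :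
    χ k ≠ 0 :=
  ((Ne.isUnit hk).map χ).ne_zero

/-! ### Fourier analysis on a finite field and the square root bound. -/

section QuadraticResidue

variable {F K : Type*} [Field F] [Fintype F] [Field K]

/-- The Fourier transform `k ↦ ∑ i, c i * ψ (k * i)` on a finite field. -/
def fourierSum (ψ : AddChar F K) (c : F → K) (k : F) : K :=
  ∑ i, c i * ψ (k * i)

/-- The additive convolution on a finite field. -/
def additiveConv (f g : F → K) (i : F) : K :=
  ∑ j, f (i - j) * g j

theorem fourierSum_additiveConv (ψ : AddChar F K) (f g : F → K) (k : F) :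
    fourierSum ψ (additiveConv f g) k = fourierSum ψ f k * fourierSum ψ g k := by
  simp only [fourierSum, additiveConv, Finset.sum_mul]
  rw [Finset.sum_comm]
  simp only [Finset.mul_sum]
  conv_rhs => rw [Finset.sum_comm]
  refine Finset.sum_congr rfl fun j _ => ?_
  rw [← Equiv.sum_comp (Equiv.subRight j) (fun x => f x * ψ (k * x) * (g j * ψ (k * j)))]
  refine Finset.sum_congr rfl fun i _ => ?_
  have h : ψ (k * i) = ψ (k * (i - j)) * ψ (k * j) := by
    rw [← AddChar.map_add_eq_mul]; congr 1; ring
  simp only [Equiv.subRight_apply, h]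
  ring

/-- Fourier inversion, by orthogonality of the shifts of a primitive character. -/
theorem sum_fourierSum_mul {ψ : AddChar F K} (hψ : ψ.IsPrimitive) (c : F → K) (i : F) :
    ∑ k, fourierSum ψ c k * ψ (k * -i) = Fintype.card F * c i := by
  classical
  simp only [fourierSum, Finset.sum_mul]
  rw [Finset.sum_comm]
  have h : ∀ j, ∑ k, c j * ψ (k * j) * ψ (k * -i) =
      c j * ((if j - i = 0 then Fintype.card F else 0 : ℕ) : K) := fun j => by
    rw [← AddChar.sum_mulShift (j - i) hψ, Finset.mul_sum]
    refine Finset.sum_congr rfl fun k _ => ?_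
    rw [mul_assoc, ← AddChar.map_add_eq_mul]
    congr 2; ring
  simp only [h, sub_eq_zero]
  rw [Finset.sum_eq_single i] <;> simp +contextual [mul_comm]

theorem eq_zero_of_fourierSum_eq_zero {ψ : AddChar F K} (hψ : ψ.IsPrimitive)
    (hF : (Fintype.card F : K) ≠ 0) {c : F → K} (hc : ∀ k, fourierSum ψ c k = 0) : c = 0 := by
  funext i
  have h := sum_fourierSum_mul hψ c i
  simp only [hc, zero_mul, Finset.sum_const_zero] at h
  exact (mul_eq_zero.mp h.symm).resolve_left hF

/-- Rescaling the summation variable by `k` pulls out `χ k⁻¹ = χ k`, so a quadratic character is its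
own transform up to the Gauss sum. -/
theorem fourierSum_mulChar {χ : MulChar F K} (hχ : χ ≠ 1) (hχ2 : χ.IsQuadratic)
    (ψ : AddChar F K) (k : F) :
    fourierSum ψ (fun i => χ i) k = χ k * gaussSum χ ψ := by
  by_cases hk : k = 0
  · subst hk
    simp [fourierSum, MulChar.sum_eq_zero_of_ne_one hχ, MulChar.map_zero χ]
  · have h := gaussSum_mulShift χ ψ (Units.mk0 k hk)
    have h1 : χ k * χ k = 1 := by
      rcases hχ2 k with h | h | h
      · exact absurd h (mulChar_ne_zero χ hk)
      · simp [h]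
      · simp [h]
    have h2 : fourierSum ψ (fun i => χ i) k = gaussSum χ (ψ.mulShift k) := by
      simp [fourierSum, gaussSum, AddChar.mulShift_apply]
    rw [h2, ← h, Units.val_mk0, ← mul_assoc, h1, one_mul]

theorem gaussSum_ne_zero_of_isQuadratic {χ : MulChar F K} (hχ : χ ≠ 1) (hχ2 : χ.IsQuadratic)
    {ψ : AddChar F K} (hψ : ψ.IsPrimitive) (hF : (Fintype.card F : K) ≠ 0) :
    gaussSum χ ψ ≠ 0 := by
  intro h
  have h1 := gaussSum_sq hχ hχ2 hψ
  rw [h, zero_pow two_ne_zero] at h1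
  rcases mul_eq_zero.mp h1.symm with h2 | h2
  · exact mulChar_ne_zero χ (neg_ne_zero.2 one_ne_zero) h2
  · exact hF h2

open Classical in
/-- The square root bound for odd-like words. -/
theorem card_le_sq_of_sum_ne_zero {χ : MulChar F K} (hχ2 : χ.IsQuadratic) {n : F}
    (hn : χ n = -1) {ψ : AddChar F K} (hψ : ψ.IsPrimitive)
    {c : F → K} (hc : ∀ k, χ k = 1 → fourierSum ψ c k = 0) (hsum : ∑ i, c i ≠ 0) :
    Fintype.card F ≤ (Finset.univ.filter fun i => c i ≠ 0).card ^ 2 := by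
  have hn0 : n ≠ 0 := by
    rintro rfl
    rw [MulChar.map_zero] at hn
    exact one_ne_zero (by linear_combination hn : (1 : K) = 0)
  -- Dilating by the nonresidue `n` swaps the roles of squares and nonsquares in the spectrum, so
  -- the transforms of `c` and `e` have product zero away from `0`.
  set e : F → K := fun j => c (n⁻¹ * j) with he
  have he1 : ∀ k, fourierSum ψ e k = fourierSum ψ c (n * k) := fun k => by
    simp only [fourierSum, he]
    rw [← Equiv.sum_comp (Equiv.mulLeft₀ n hn0)]
    refine Finset.sum_congr rfl fun j _ => ?_
    rw [Equiv.mulLeft₀_apply, inv_mul_cancel_left₀ hn0]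
    congr 2; ring
  have hconv : ∀ k, k ≠ 0 → fourierSum ψ (additiveConv c e) k = 0 := fun k hk => by
    rw [fourierSum_additiveConv, he1]
    rcases hχ2 k with h | h | h
    · exact absurd h (mulChar_ne_zero χ hk)
    · rw [hc k h, zero_mul]
    · rw [hc (n * k) (by rw [map_mul, hn, h]; ring), mul_zero]
  have h0 : ∀ f : F → K, fourierSum ψ f 0 = ∑ i, f i := fun f => by simp [fourierSum]
  -- Only frequency `0` survives in the inversion formula: `card F` times each value of the
  -- convolution is `(∑ c) ^ 2`.
  have hne : ∀ i, additiveConv c e i ≠ 0 := fun i hi => by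
    have h := sum_fourierSum_mul hψ (additiveConv c e) i
    rw [Finset.sum_eq_single 0 (fun k _ hk => by rw [hconv k hk, zero_mul]) (by simp),
      fourierSum_additiveConv, he1, mul_zero, h0, hi] at h
    simp only [zero_mul, AddChar.map_zero_eq_one, mul_one, mul_zero, mul_self_eq_zero] at h
    exact hsum h
  set S := Finset.univ.filter fun i => c i ≠ 0 with hS
  -- A convolution with no zero value forces every field element to be a sum of a point of `S` and
  -- one of `n S`.
  have hsub : (Finset.univ : Finset F) ⊆ (S ×ˢ S).image fun p => p.1 + n * p.2 := by
    intro i _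
    obtain ⟨j, -, hj⟩ := Finset.exists_ne_zero_of_sum_ne_zero (hne i)
    refine Finset.mem_image.2 ⟨(i - j, n⁻¹ * j), ?_, ?_⟩
    · simpa [hS, he] using hj
    · simp [mul_inv_cancel_left₀ hn0]
  calc Fintype.card F = (Finset.univ : Finset F).card := rfl
    _ ≤ _ := Finset.card_le_card hsub
    _ ≤ (S ×ˢ S).card := Finset.card_image_le
    _ = S.card ^ 2 := by rw [Finset.card_product, sq]

/-- Moving the coordinate at infinity of the extended quadratic residue code to the position `a`:
an even-like word that vanishes on the squares yields another word that vanishes on the squares. -/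
theorem additiveConv_mulChar_inversion {χ : MulChar F K} (hχ2 : χ.IsQuadratic) {G : K} {c : F → K}
    (hconv : ∀ i, additiveConv (fun j => χ j) c i = -G * c i) (hsum : ∑ i, c i = 0) (a i : F) :
    additiveConv (fun j => χ j) (fun j => χ j * c (a - j⁻¹)) i =
      -G * (χ i * c (a - i⁻¹)) - χ (-1) * c a := by
  classical
  have hinv : ∀ x, χ x⁻¹ = χ x := fun x => by
    rw [← MulChar.inv_apply', hχ2.inv]
  have hreindex : ∀ f : F → K, ∑ j, f j = ∑ k, f (a - k)⁻¹ := fun f =>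
    (Equiv.sum_comp ((Equiv.subLeft a).trans (Equiv.inv F)) f).symm
  -- At `k = a` the convention `0⁻¹ = 0` makes the left side vanish through `χ 0 = 0`; the
  -- correction term cancels what the uniform formula would contribute there.
  have hkey : ∀ k, χ (i - (a - k)⁻¹) * (χ (a - k)⁻¹ * c (a - ((a - k)⁻¹)⁻¹)) =
      χ (i * (a - k) - 1) * c k - if k = a then χ (-1) * c a else 0 := fun k => by
    by_cases hk : k = a
    · subst hk; simp [MulChar.map_zero χ]
    · have h : a - k ≠ 0 := sub_ne_zero.2 (Ne.symm hk)
      rw [inv_inv, sub_sub_cancel, if_neg hk, sub_zero, hinv, ← mul_assoc, ← map_mul, sub_mul,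
        inv_mul_cancel₀ h]
  have hlhs : additiveConv (fun j => χ j) (fun j => χ j * c (a - j⁻¹)) i =
      ∑ k, χ (i * (a - k) - 1) * c k - χ (-1) * c a := by
    rw [additiveConv, hreindex]
    simp only [hkey, Finset.sum_sub_distrib, Finset.sum_ite_eq', Finset.mem_univ, if_true]
  rw [hlhs]
  congr 1
  by_cases hi : i = 0
  · subst hi
    simp [← Finset.mul_sum, hsum, MulChar.map_zero χ]
  · have h := hconv (a - i⁻¹)
    rw [additiveConv] at h
    calc ∑ k, χ (i * (a - k) - 1) * c k = χ i * ∑ k, χ (a - i⁻¹ - k) * c k := by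
          rw [Finset.mul_sum]
          refine Finset.sum_congr rfl fun k _ => ?_
          rw [← mul_assoc, ← map_mul]
          congr 2
          field_simp
          ring
      _ = _ := by rw [h]; ring

open Classical in
/-- The square root bound for quadratic residue codes. -/
theorem card_le_sq_of_fourierSum_eq_zero {χ : MulChar F K} (hχ2 : χ.IsQuadratic) {n : F}
    (hn : χ n = -1) (h2 : (2 : K) ≠ 0) {ψ : AddChar F K} (hψ : ψ.IsPrimitive)
    (hF : (Fintype.card F : K) ≠ 0) {c : F → K} (hc : ∀ k, χ k = 1 → fourierSum ψ c k = 0)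
    (hc0 : c ≠ 0) :
    Fintype.card F ≤ (Finset.univ.filter fun i => c i ≠ 0).card ^ 2 := by
  by_cases hsum : ∑ i, c i = 0
  swap
  · exact card_le_sq_of_sum_ne_zero hχ2 hn hψ hc hsum
  have hn0 : n ≠ 0 := by
    rintro rfl
    rw [MulChar.map_zero] at hn
    exact one_ne_zero (by linear_combination hn : (1 : K) = 0)
  have hχ : χ ≠ 1 := by
    rintro rfl
    rw [MulChar.one_apply (Ne.isUnit hn0)] at hn
    exact h2 (by linear_combination hn)
  set G := gaussSum χ ψ with hGdef
  have hG : G ≠ 0 := gaussSum_ne_zero_of_isQuadratic hχ hχ2 hψ hF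
  have h0 : ∀ f : F → K, fourierSum ψ f 0 = ∑ i, f i := fun f => by simp [fourierSum]
  -- The transform of `c` is supported on the nonsquares, where that of `χ` is constantly `-G`.
  have hconv : ∀ i, additiveConv (fun j => χ j) c i = -G * c i := by
    have : (fun i => additiveConv (fun j => χ j) c i + G * c i) = 0 := by
      refine eq_zero_of_fourierSum_eq_zero hψ hF fun k => ?_
      have h : fourierSum ψ (fun i => additiveConv (fun j => χ j) c i + G * c i) k =
          fourierSum ψ (additiveConv (fun j => χ j) c) k + G * fourierSum ψ c k := by
        simp only [fourierSum, add_mul, Finset.sum_add_distrib, Finset.mul_sum, mul_assoc]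
      rw [h, fourierSum_additiveConv, fourierSum_mulChar hχ hχ2]
      rcases hχ2 k with hk | hk | hk
      · have hk0 : k = 0 := by
          by_contra hne
          exact mulChar_ne_zero χ hne hk
        rw [hk0, h0 c, hsum, mul_zero, mul_zero, add_zero]
      · rw [hc k hk, mul_zero, mul_zero, add_zero]
      · rw [hk]; ring
    intro i
    have := congrFun this i
    simp only [Pi.zero_apply] at this
    linear_combination this
  obtain ⟨a, ha⟩ := Function.ne_iff.1 hc0
  have hd := additiveConv_mulChar_inversion hχ2 hconv hsum a
  -- The inversion sends the nonzero entry at `a` to infinity, which makes the coordinate sum of `d`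
  -- nonzero, while the support of `d` still injects into that of `c`.
  set d : F → K := fun j => χ j * c (a - j⁻¹) with hddef
  have hdsum : ∑ j, d j = -G * c a := by
    rw [← hconv a, additiveConv, ← Equiv.sum_comp ((Equiv.subLeft a).trans (Equiv.inv F)) d]
    refine Finset.sum_congr rfl fun k _ => ?_
    have hinv : χ (a - k)⁻¹ = χ (a - k) := by rw [← MulChar.inv_apply', hχ2.inv]
    simp [hddef, hinv]
  have hdv : ∀ k, χ k = 1 → fourierSum ψ d k = 0 := fun k hk => by
    have hk0 : k ≠ 0 := by
      rintro rfl
      rw [MulChar.map_zero] at hk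
      exact zero_ne_one hk
    have h1 := fourierSum_additiveConv ψ (fun j => χ j) d k
    rw [fourierSum_mulChar hχ hχ2, hk, funext hd] at h1
    have h3 : ∑ i, ψ (k * i) = 0 := by
      have := AddChar.sum_mulShift k hψ
      rw [if_neg hk0] at this
      simpa [mul_comm] using this
    have h4 : fourierSum ψ (fun i => -G * d i - χ (-1) * c a) k = -G * fourierSum ψ d k := by
      simp only [fourierSum, sub_mul, Finset.sum_sub_distrib, mul_assoc, ← Finset.mul_sum, h3,
        mul_zero, sub_zero]
    have h5 : fourierSum ψ (fun i => -G * (χ i * c (a - i⁻¹)) - χ (-1) * c a) k =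
        -G * fourierSum ψ d k := h4
    rw [h5] at h1
    -- On a square `k`, convolving with `χ` multiplies the transform of `d` by `G`, while the
    -- inversion identity says `-G`, its constant term being invisible at `k ≠ 0`.
    have h6 : 2 * (G * fourierSum ψ d k) = 0 := by linear_combination -h1
    exact (mul_eq_zero.1 ((mul_eq_zero.1 h6).resolve_left h2)).resolve_left hG
  refine (card_le_sq_of_sum_ne_zero hχ2 hn hψ hdv ?_).trans ?_
  · rw [hdsum]
    exact mul_ne_zero (neg_ne_zero.2 hG) ha
  · refine Nat.pow_le_pow_left (Finset.card_le_card_of_injOn (fun j => a - j⁻¹) ?_ ?_) 2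
    · intro j hj
      simp only [hddef, ne_eq, mul_eq_zero, not_or, Finset.coe_filter, Finset.mem_univ, true_and,
        Set.mem_ofPred_eq] at hj ⊢
      exact hj.2
    · intro x _ y _ h
      simpa using h

end QuadraticResidue

end NegacyclicCode

namespace NegacyclicCode

/-! ### Duals of the two codes as words with a prescribed zero. -/

section Duals

variable {F : Type*} [Field F] {n : ℕ}

theorem monic_X_pow_add_one (hn : 0 < n) : (X ^ n + 1 : F[X]).Monic := by
  simpa using monic_X_pow_add_C (1 : F) hn.ne'

theorem natDegree_X_pow_add_one : (X ^ n + 1 : F[X]).natDegree = n := by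
  simpa using natDegree_X_pow_add_C (n := n) (r := (1 : F))

theorem root_pow_eq_neg_one : AdjoinRoot.root (X ^ n + 1 : F[X]) ^ n = -1 := by
  have h := AdjoinRoot.mk_self (f := (X ^ n + 1 : F[X]))
  rw [map_add, map_pow, AdjoinRoot.mk_X, map_one] at h
  exact eq_neg_of_add_eq_zero_left h

/-- The constant coefficient of an element of `F[x] / (x ^ n + 1)`. -/
noncomputable def constCoeff (hn : 0 < n) : AdjoinRoot (X ^ n + 1 : F[X]) →ₗ[F] F :=
  (lcoeff F 0) ∘ₗ AdjoinRoot.modByMonicHom (monic_X_pow_add_one hn)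

theorem constCoeff_root_pow (hn : 0 < n) {i : ℕ} (hi : i < n) :
    constCoeff hn (AdjoinRoot.root (X ^ n + 1 : F[X]) ^ i) = if i = 0 then 1 else 0 := by
  have h : (X ^ i : F[X]) %ₘ (X ^ n + 1) = X ^ i := by
    rw [modByMonic_eq_self_iff (monic_X_pow_add_one hn), degree_X_pow,
      degree_eq_natDegree (monic_X_pow_add_one hn).ne_zero, natDegree_X_pow_add_one]
    exact_mod_cast hi
  rw [constCoeff, ← AdjoinRoot.mk_X, ← map_pow, LinearMap.comp_apply, AdjoinRoot.modByMonicHom_mk,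
    h, lcoeff_apply, coeff_X_pow]
  simp [eq_comm]

/-- The inverse `-x ^ (n - 1)` of `x` in `F[x] / (x ^ n + 1)`. -/
noncomputable def invRoot (F : Type*) [Field F] (n : ℕ) : AdjoinRoot (X ^ n + 1 : F[X]) :=
  -AdjoinRoot.root (X ^ n + 1 : F[X]) ^ (n - 1)

theorem invRoot_mul_root (hn : 0 < n) :
    invRoot F n * AdjoinRoot.root (X ^ n + 1 : F[X]) = 1 := by
  rw [invRoot, neg_mul, ← pow_succ, Nat.sub_add_cancel hn, root_pow_eq_neg_one, neg_neg]

theorem constCoeff_invRoot_pow_mul_root_pow (hn : 0 < n) (i j : Fin n) :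
    constCoeff hn (invRoot F n ^ (i : ℕ) * AdjoinRoot.root (X ^ n + 1 : F[X]) ^ (j : ℕ)) =
      if i = j then 1 else 0 := by
  rcases le_or_gt (i : ℕ) (j : ℕ) with h | h
  · obtain ⟨k, hk⟩ := Nat.exists_eq_add_of_le h
    rw [hk, pow_add, ← mul_assoc, ← mul_pow, invRoot_mul_root hn, one_pow, one_mul,
      constCoeff_root_pow hn (by omega)]
    congr 1
    rw [Fin.ext_iff, hk]
    simp
  · obtain ⟨k, hk⟩ := Nat.exists_eq_add_of_lt h
    have hk' : k + 1 ≤ n := by omega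
    have h1 : invRoot F n ^ (k + 1) =
        -AdjoinRoot.root (X ^ n + 1 : F[X]) ^ (n - (k + 1)) := by
      have h2 : AdjoinRoot.root (X ^ n + 1 : F[X]) ^ (n - (k + 1)) *
          AdjoinRoot.root (X ^ n + 1 : F[X]) ^ (k + 1) = -1 := by
        rw [← pow_add, Nat.sub_add_cancel hk', root_pow_eq_neg_one]
      calc invRoot F n ^ (k + 1)
          = invRoot F n ^ (k + 1) * -(AdjoinRoot.root (X ^ n + 1 : F[X]) ^ (n - (k + 1)) *
            AdjoinRoot.root (X ^ n + 1 : F[X]) ^ (k + 1)) := by rw [h2, neg_neg, mul_one]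
        _ = -AdjoinRoot.root (X ^ n + 1 : F[X]) ^ (n - (k + 1)) *
            (invRoot F n * AdjoinRoot.root (X ^ n + 1 : F[X])) ^ (k + 1) := by
              rw [mul_pow]; ring
        _ = _ := by rw [invRoot_mul_root hn, one_pow, mul_one]
    rw [hk, add_assoc, pow_add, mul_right_comm, ← mul_pow, invRoot_mul_root hn, one_pow, one_mul,
      h1, map_neg, constCoeff_root_pow hn (by omega), if_neg (by omega), if_neg, neg_zero]
    rintro rfl
    omega

/-- The standard pairing is the constant coefficient of `c(x⁻¹) b(x)`, which turns orthogonality to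
an ideal into annihilation of its generator. -/
theorem constCoeff_sum_mul_toQuotient (hn : 0 < n) (c b : Fin n → F) :
    constCoeff hn ((∑ i, c i • invRoot F n ^ (i : ℕ)) * toQuotient F n b) = ∑ i, c i * b i := by
  rw [toQuotient, Fintype.linearCombination_apply, Finset.sum_mul_sum, map_sum]
  refine Finset.sum_congr rfl fun i _ => ?_
  rw [map_sum]
  simp only [smul_mul_smul_comm, map_smul, constCoeff_invRoot_pow_mul_root_pow, smul_eq_mul,
    mul_ite, mul_one, mul_zero, Finset.sum_ite_eq, Finset.mem_univ, if_true]

theorem toQuotient_surjective (hn : 0 < n) : Function.Surjective (toQuotient F n) := by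
  intro z
  obtain ⟨p, rfl⟩ := AdjoinRoot.mk_surjective z
  refine ⟨fun i => (p %ₘ (X ^ n + 1)).coeff i, ?_⟩
  have h1 : (p %ₘ (X ^ n + 1)).natDegree < n := by
    have := natDegree_modByMonic_lt p (monic_X_pow_add_one (F := F) hn) (by
      intro h
      have := natDegree_X_pow_add_one (F := F) (n := n)
      rw [h, natDegree_one] at this
      omega)
    rwa [natDegree_X_pow_add_one] at this
  have h2 : AdjoinRoot.mk (X ^ n + 1 : F[X]) p = AdjoinRoot.mk _ (p %ₘ (X ^ n + 1)) := by
    rw [AdjoinRoot.mk_eq_mk]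
    exact ⟨p /ₘ (X ^ n + 1), by
      linear_combination -modByMonic_add_div p (X ^ n + 1 : F[X])⟩
  rw [h2, toQuotient, Fintype.linearCombination_apply]
  conv_rhs => rw [as_sum_range_C_mul_X_pow' _ h1, map_sum]
  rw [← Fin.sum_univ_eq_sum_range (fun i => AdjoinRoot.mk (X ^ n + 1 : F[X])
    (C ((p %ₘ (X ^ n + 1)).coeff i) * X ^ i))]
  refine Finset.sum_congr rfl fun i _ => ?_
  rw [map_mul, map_pow, AdjoinRoot.mk_X, AdjoinRoot.mk_C, Algebra.smul_def]
  rfl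

theorem eq_zero_of_constCoeff_mul_eq_zero (hn : 0 < n) {w : AdjoinRoot (X ^ n + 1 : F[X])}
    (hw : ∀ y, constCoeff hn (y * w) = 0) : w = 0 := by
  classical
  obtain ⟨b, rfl⟩ := toQuotient_surjective hn w
  have hb : b = 0 := by
    funext i
    have h := constCoeff_sum_mul_toQuotient hn (Pi.single i 1) b
    rw [hw] at h
    simpa [Pi.single_apply] using h.symm
  rw [hb, map_zero]

/-- The dual of the code with check polynomial `minpoly F β` consists of the words that vanish at
`β⁻¹`. -/
theorem mem_dualCode_codeOfCheckPoly_minpoly {K : Type*} [Field K] [Algebra F K] (hn : 0 < n)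
    {β : K} (hβ : β ^ n = -1) (c : Fin n → F) :
    c ∈ dualCode (codeOfCheckPoly n (minpoly F β)) ↔ ∑ i, c i • β⁻¹ ^ (i : ℕ) = 0 := by
  have hβ0 : β ≠ 0 := by
    rintro rfl
    rw [zero_pow hn.ne'] at hβ
    exact one_ne_zero (by linear_combination hβ : (1 : K) = 0)
  obtain ⟨g, hg⟩ : minpoly F β ∣ X ^ n + 1 := minpoly.dvd F β (by simp [hβ])
  have hm0 : minpoly F β ≠ 0 := by
    intro h
    rw [h, zero_mul] at hg
    exact (monic_X_pow_add_one hn).ne_zero hg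
  have hg0 : g ≠ 0 := by
    rintro rfl
    rw [mul_zero] at hg
    exact (monic_X_pow_add_one hn).ne_zero hg
  have hdiv : (X ^ n + 1) / minpoly F β = g := by
    rw [hg, mul_div_cancel_left₀ _ hm0]
  set f : F[X] := X ^ n + 1 with hf
  -- A polynomial representing `c(x⁻¹)`: its value at `β` is `c(β⁻¹)`, and it kills the generator
  -- `g` iff `minpoly F β` divides it.
  set P : F[X] := ∑ i : Fin n, C (c i) * (-X ^ (n - 1)) ^ (i : ℕ) with hP
  have hPmk : AdjoinRoot.mk f P = ∑ i, c i • invRoot F n ^ (i : ℕ) := by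
    rw [hP, map_sum]
    refine Finset.sum_congr rfl fun i _ => ?_
    rw [map_mul, map_pow, map_neg, map_pow, AdjoinRoot.mk_X, AdjoinRoot.mk_C, Algebra.smul_def]
    rfl
  have hPβ : aeval β P = ∑ i, c i • β⁻¹ ^ (i : ℕ) := by
    have h : -β ^ (n - 1) = β⁻¹ := by
      refine eq_inv_of_mul_eq_one_left ?_
      rw [neg_mul, ← pow_succ, Nat.sub_add_cancel hn, hβ, neg_neg]
    simp [hP, h, Algebra.smul_def]
  have hdual : c ∈ dualCode (codeOfCheckPoly n (minpoly F β)) ↔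
      AdjoinRoot.mk f P * AdjoinRoot.mk f g = 0 := by
    constructor
    · intro hc
      refine eq_zero_of_constCoeff_mul_eq_zero hn fun y => ?_
      obtain ⟨b, hb⟩ := toQuotient_surjective hn (y * AdjoinRoot.mk f g)
      have h := hc b (by
        change toQuotient F n b ∈ Ideal.span {AdjoinRoot.mk f (f / minpoly F β)}
        rw [hdiv, hb]
        exact Ideal.mul_mem_left _ _ (Ideal.mem_span_singleton_self _))
      rw [← constCoeff_sum_mul_toQuotient hn, hb, ← hPmk] at h
      rw [← h]
      congr 1
      ring
    · intro h b hb
      change toQuotient F n b ∈ Ideal.span {AdjoinRoot.mk f (f / minpoly F β)} at hb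
      rw [hdiv, Ideal.mem_span_singleton'] at hb
      obtain ⟨y, hy⟩ := hb
      rw [← constCoeff_sum_mul_toQuotient hn, ← hy, ← hPmk, mul_left_comm, h, mul_zero, map_zero]
  rw [hdual, ← map_mul, AdjoinRoot.mk_eq_zero, hg, mul_dvd_mul_iff_right hg0, ← hPβ]
  exact ⟨fun h => aeval_eq_zero_of_dvd_aeval_eq_zero h (minpoly.aeval F β), minpoly.dvd F β⟩

/-- The dual of a trace code consists of the words that vanish at `θ ^ 2`. -/
theorem mem_dualCode_traceCode {E K : Type*} [Field E] [Field K] [Algebra E K]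
    [FiniteDimensional E K] [Algebra.IsSeparable E K] {θ : K} (c : Fin n → E) :
    c ∈ dualCode (traceCode E n θ) ↔ ∑ i, c i • θ ^ (2 * (i : ℕ)) = 0 := by
  have h : ∀ a, ∑ i, c i * Algebra.trace E K (a * θ ^ (2 * (i : ℕ))) =
      Algebra.traceForm E K a (∑ i, c i • θ ^ (2 * (i : ℕ))) := fun a => by
    simp [Algebra.traceForm_apply]
  constructor
  · intro hc
    refine (traceForm_nondegenerate E K).2 _ fun a => ?_
    rw [← h]
    exact hc _ (mem_traceCode.2 ⟨a, rfl⟩)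
  · intro h0 b hb
    obtain ⟨a, rfl⟩ := mem_traceCode.1 hb
    rw [h a, h0, map_zero]

/-- A code that consists of the words vanishing at an `n`-th root of `-1` is negacyclic. -/
theorem isNegacyclic_of_mem_iff {K : Type*} [Field K] [Algebra F K] {θ : K}
    (hθ : θ ^ n = -1) {C : Submodule F (Fin n → F)}
    (hC : ∀ c, c ∈ C ↔ ∑ i, c i • θ ^ (i : ℕ) = 0) : IsNegacyclic C := by
  intro c hc
  rw [hC] at hc ⊢
  rcases n with _ | n
  · simp
  rw [Fin.sum_univ_succ]
  rw [Fin.sum_univ_castSucc] at hc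
  have hlast : ∀ h, (⟨n, h⟩ : Fin (n + 1)) = Fin.last n := fun _ => rfl
  have hcast : ∀ (i : Fin n) h, (⟨(i : ℕ), h⟩ : Fin (n + 1)) = i.castSucc := fun _ _ => rfl
  simp only [constacyclicShift, Fin.val_zero, if_true, Fin.val_succ, Nat.add_eq_zero_iff,
    one_ne_zero, and_false, if_false, add_tsub_cancel_right, hlast, hcast, pow_zero]
  simp only [Fin.val_castSucc, Fin.val_last] at hc
  have h := congrArg (θ * ·) hc
  simp only [mul_add, Finset.mul_sum, mul_zero, mul_smul_comm, ← pow_succ', hθ] at h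
  rw [← h, add_comm]
  simp

end Duals

end NegacyclicCode

namespace NegacyclicCode

/-! ### Minimum distance as minimum weight. -/

section Weights

open Classical in
/-- The Hamming weight of a word. -/
noncomputable def weight {ι F : Type*} [Fintype ι] [Field F] (c : ι → F) : ℕ :=
  (Finset.univ.filter fun i => c i ≠ 0).card

theorem hammingDist_eq_weight_sub {F : Type*} [Field F] [DecidableEq F] {n : ℕ}
    (x y : Fin n → F) : hammingDist x y = weight (x - y) := by
  simp only [hammingDist, weight, Pi.sub_apply, sub_ne_zero]

theorem minDist_le_weight {F : Type*} [Field F] {n : ℕ} {C : Submodule F (Fin n → F)}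
    {x : Fin n → F} (hx : x ∈ C) (hx0 : x ≠ 0) : minDist C ≤ weight x :=
  Nat.sInf_le ⟨x, hx, 0, C.zero_mem, hx0, by
    classical rw [hammingDist_eq_weight_sub, sub_zero]⟩

theorem exists_weight_eq_minDist {F : Type*} [Field F] {n : ℕ} {C : Submodule F (Fin n → F)}
    (hC : ∃ x ∈ C, x ≠ 0) : ∃ x ∈ C, x ≠ 0 ∧ weight x = minDist C := by
  classical
  obtain ⟨x, hx, hx0⟩ := hC
  have hne : {d | ∃ x ∈ C, ∃ y ∈ C, x ≠ y ∧ hammingDist x y = d}.Nonempty :=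
    ⟨_, x, hx, 0, C.zero_mem, hx0, rfl⟩
  obtain ⟨y, hy, z, hz, hyz, hd⟩ := Nat.sInf_mem hne
  refine ⟨y - z, C.sub_mem hy hz, sub_ne_zero.2 hyz, ?_⟩
  rw [← hammingDist_eq_weight_sub, hd, minDist]

end Weights

/-! ### From ternary words of length `2 ρ` to words of length `ρ`. -/

section Pairing

/-- The odd or even counterpart of `2 j` in the pairing of `i` with `i + ρ` modulo `2 ρ`. -/
def partner (ρ : ℕ) (j : Fin ρ) : Fin (2 * ρ) :=
  ⟨if 2 * (j : ℕ) < ρ then 2 * j + ρ else 2 * j - ρ, by split_ifs <;> omega⟩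

/-- For odd `ρ`, the positions `0, …, 2 ρ - 1` are the numbers `2 j` and their partners. -/
theorem bijective_elim_partner {ρ : ℕ} (hρ : Odd ρ) :
    Function.Bijective (Sum.elim (fun j : Fin ρ => (⟨2 * j, by omega⟩ : Fin (2 * ρ)))
      (partner ρ)) := by
  obtain ⟨r, hr⟩ := hρ
  rw [Fintype.bijective_iff_injective_and_card]
  constructor
  · rintro (i | i) (j | j) h <;>
      simp only [Sum.elim_inl, Sum.elim_inr, partner, Fin.mk.injEq] at h
    · congr 1; ext; omega
    · split_ifs at h <;> omega
    · split_ifs at h <;> omega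
    · congr 1; ext; split_ifs at h <;> omega
  · simp [two_mul]

/-- Multiplying by the conjugate gives the norm `a² + b²`, which is anisotropic over GF(3) because
`-1` is not a square there. -/
theorem add_mul_eq_zero_of_sq_eq_neg_one {E : Type*} [Field E] (φ : ZMod 3 →+* E) {u : E}
    (hu : u ^ 2 = -1) {a b : ZMod 3} (h : φ a + u * φ b = 0) : a = 0 ∧ b = 0 := by
  have h1 : φ (a ^ 2 + b ^ 2) = 0 := by
    rw [map_add, map_pow, map_pow]
    linear_combination (φ a - u * φ b) * h + φ b ^ 2 * hu
  have h2 : a ^ 2 + b ^ 2 = 0 := (map_eq_zero φ).1 h1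
  clear h h1
  decide +revert

/-- A ternary word of length `2 ρ` that vanishes at `θ` gives a word of length `ρ` over an extension
containing `θ ^ ρ` that vanishes at `θ ^ 2` and is not heavier. -/
theorem exists_weight_le_of_vanishing {ρ : ℕ} (hρ : Odd ρ) {E K : Type*} [Field E] [Field K]
    [Algebra (ZMod 3) K] [Algebra E K] (φ : ZMod 3 →+* E) {θ : K} {u : E}
    (hu : algebraMap E K u = θ ^ ρ) (hu2 : u ^ 2 = -1) {c : Fin (2 * ρ) → ZMod 3} (hc0 : c ≠ 0)
    (hc : ∑ i, c i • θ ^ (i : ℕ) = 0) :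
    ∃ e : Fin ρ → E, e ≠ 0 ∧ ∑ j, e j • θ ^ (2 * (j : ℕ)) = 0 ∧ weight e ≤ weight c := by
  classical
  have hbij := bijective_elim_partner hρ
  set p : Fin ρ → Fin (2 * ρ) := fun j => ⟨2 * j, by omega⟩ with hp
  -- The sign records the wrap-around: `θ ^ (-ρ) = -θ ^ ρ`.
  set v : Fin ρ → E := fun j => if 2 * (j : ℕ) < ρ then u else -u with hv
  have hv2 : ∀ j, v j ^ 2 = -1 := fun j => by
    simp only [hv]; split_ifs <;> simp [hu2]
  have hφ : ∀ a, algebraMap E K (φ a) = algebraMap (ZMod 3) K a := fun a =>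
    RingHom.congr_fun (Subsingleton.elim ((algebraMap E K).comp φ) (algebraMap (ZMod 3) K)) a
  have hθ : ∀ j, algebraMap E K (v j) * θ ^ (2 * (j : ℕ)) = θ ^ (partner ρ j : ℕ) := fun j => by
    simp only [hv, partner]
    split_ifs with h
    · rw [hu, ← pow_add, add_comm]
    · have h1 : θ ^ (2 * (j : ℕ)) = θ ^ (2 * (j : ℕ) - ρ) * θ ^ ρ := by
        rw [← pow_add, Nat.sub_add_cancel (not_lt.1 h)]
      have h2 : θ ^ ρ * θ ^ ρ = -1 := by
        rw [← hu, ← map_mul, ← sq, hu2, map_neg, map_one]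
      rw [h1, map_neg, hu]
      linear_combination -θ ^ (2 * (j : ℕ) - ρ) * h2
  refine ⟨fun j => φ (c (p j)) + v j * φ (c (partner ρ j)), ?_, ?_, ?_⟩
  · intro h0
    refine hc0 (funext fun i => ?_)
    have hz := fun j => add_mul_eq_zero_of_sq_eq_neg_one φ (hv2 j) (congrFun h0 j)
    obtain ⟨j | j, rfl⟩ := hbij.2 i
    · exact (hz j).1
    · exact (hz j).2
  · rw [← hc, ← hbij.sum_comp (fun i => c i • θ ^ (i : ℕ)), Fintype.sum_sum_type,
      ← Finset.sum_add_distrib]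
    refine Finset.sum_congr rfl fun j _ => ?_
    simp only [Sum.elim_inl, Sum.elim_inr, Algebra.smul_def, map_add, map_mul, hφ, ← hθ, hp]
    ring
  -- Choose one nonzero entry of `c` in each pair where the new word is nonzero; distinct pairs are
  -- disjoint.
  · set s : Fin ρ → Fin (2 * ρ) := fun j => if c (p j) ≠ 0 then p j else partner ρ j with hs
    refine Finset.card_le_card_of_injOn s ?_ ?_
    · intro j hj
      simp only [ne_eq, Finset.coe_filter, Finset.mem_univ, true_and, Set.mem_ofPred_eq, hs]
        at hj ⊢
      split_ifs with h
      · intro h'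
        exact hj (by simp [h, h'])
      · exact h
    · intro i _ j _ h
      have hs' : ∀ j, ∃ t : Fin ρ ⊕ Fin ρ, Sum.elim p (partner ρ) t = s j ∧
          Sum.elim id id t = j := fun j => by
        by_cases h : c (p j) ≠ 0
        · exact ⟨Sum.inl j, by simp [hs, h], rfl⟩
        · exact ⟨Sum.inr j, by simp only [hs, if_neg h, Sum.elim_inr], rfl⟩
      obtain ⟨t, ht, rfl⟩ := hs' i
      obtain ⟨t', ht', rfl⟩ := hs' j
      rw [hbij.1 (ht.trans (h.trans ht'.symm))]

end Pairing

/-! ### The twisted word over GF(9) lies in a quadratic residue code. -/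

section SquareRootBound

/-- The positions `0, …, n - 1` as residues modulo `n`. -/
def finEquivZMod (n : ℕ) [NeZero n] : Fin n ≃ ZMod n where
  toFun i := ((i : ℕ) : ZMod n)
  invFun x := ⟨x.val, ZMod.val_lt x⟩
  left_inv i := Fin.ext (ZMod.val_cast_of_lt i.isLt)
  right_inv x := ZMod.natCast_zmod_val x

theorem exists_pow_of_isSquare {ρ : ℕ} [Fact ρ.Prime] (hord : orderOf (3 : ZMod ρ) = ρ - 1)
    {k : ZMod ρ} (hk : IsSquare k) (hk0 : k ≠ 0) : ∃ a : ℕ, k = ((9 ^ a : ℕ) : ZMod ρ) := by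
  obtain ⟨t, rfl⟩ := hk
  have ht : t ≠ 0 := fun h => hk0 (by rw [h, mul_zero])
  have h3 : IsPrimitiveRoot (3 : ZMod ρ) (ρ - 1) := hord ▸ IsPrimitiveRoot.orderOf _
  have : NeZero (ρ - 1) := ⟨by have := (Fact.out : ρ.Prime).two_le; omega⟩
  obtain ⟨a, -, rfl⟩ := h3.eq_pow_of_pow_eq_one (ZMod.pow_card_sub_one_eq_one ht)
  refine ⟨a, ?_⟩
  push_cast
  rw [← mul_pow]
  norm_num

theorem le_weight_sq_of_vanishing {ρ : ℕ} [Fact ρ.Prime] (hρ2 : ρ ≠ 2) (hρ3 : ρ ≠ 3)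
    (hord : orderOf (3 : ZMod ρ) = ρ - 1) {E K : Type*} [Field E] [Field K] [CharP K 3]
    [Algebra E K] (hE : Nat.card E = 3 ^ 2) {θ : K} (hθ : IsPrimitiveRoot θ (4 * ρ))
    {c : Fin ρ → E} (hc0 : c ≠ 0) (hc : ∑ j, c j • θ ^ (2 * (j : ℕ)) = 0) :
    ρ ≤ weight c ^ 2 := by
  classical
  have hρ : ρ.Prime := Fact.out
  have : Finite E := Nat.finite_of_card_ne_zero (by rw [hE]; norm_num)
  have : Fintype E := Fintype.ofFinite E
  have : Fact (Nat.Prime 3) := ⟨Nat.prime_three⟩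
  have hE' : Fintype.card E = 9 := by rw [← Nat.card_eq_fintype_card, hE]; norm_num
  have h2 : (2 : K) ≠ 0 := by
    intro h
    have := (CharP.cast_eq_zero_iff K 3 2).1 (by exact_mod_cast h)
    omega
  have hF : (Fintype.card (ZMod ρ) : K) ≠ 0 := by
    rw [ZMod.card]
    intro h
    exact hρ3 ((Nat.prime_dvd_prime_iff_eq Nat.prime_three hρ).1
      ((CharP.cast_eq_zero_iff K 3 ρ).1 h)).symm
  have hθ2ρ : θ ^ (2 * ρ) = -1 :=
    (hθ.pow (by have := hρ.pos; omega) (by ring : 4 * ρ = 2 * ρ * 2)).eq_neg_one_of_two_right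
  set δ : K := -θ ^ 2 with hδ
  have hδρ : δ ^ ρ = 1 := by
    rw [hδ, Odd.neg_pow (hρ.odd_of_ne_two hρ2), ← pow_mul, hθ2ρ, neg_neg]
  have hδ1 : δ ≠ 1 := by
    intro h
    have h4 : θ ^ 4 = 1 := by
      rw [hδ] at h
      linear_combination (1 - θ ^ 2) * h
    have := Nat.le_of_dvd (by norm_num) (hθ.dvd_of_pow_eq_one 4 h4)
    have := hρ.two_le
    omega
  have hδp : IsPrimitiveRoot δ ρ := orderOf_eq_prime hδρ hδ1 ▸ IsPrimitiveRoot.orderOf δ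
  set ψ : AddChar (ZMod ρ) K := AddChar.zmodChar ρ hδρ with hψdef
  have hψ : ψ.IsPrimitive := AddChar.zmodChar_primitive_of_primitive_root ρ hδp
  set χ : MulChar (ZMod ρ) K := (quadraticChar (ZMod ρ)).ringHomComp (Int.castRingHom K) with hχ
  have hχ2 : χ.IsQuadratic := (quadraticChar_isQuadratic _).comp _
  obtain ⟨n, hn⟩ := quadraticChar_exists_neg_one (F := ZMod ρ) (by rwa [ZMod.ringChar_zmod_n])
  have hχn : χ n = -1 := by simp [hχ, MulChar.ringHomComp_apply, hn]
  set c' : ZMod ρ → K := fun x =>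
    (-1) ^ x.val * algebraMap E K (c ((finEquivZMod ρ).symm x)) with hc'
  have hc'e : ∀ i, c' (finEquivZMod ρ i) = (-1) ^ (i : ℕ) * algebraMap E K (c i) := fun i => by
    have h : (finEquivZMod ρ i).val = (i : ℕ) := ZMod.val_cast_of_lt i.isLt
    simp only [hc', Equiv.symm_apply_apply, h]
  have hvan : ∀ k, χ k = 1 → fourierSum ψ c' k = 0 := by
    intro k hk
    have hk0 : k ≠ 0 := by
      rintro rfl
      rw [MulChar.map_zero χ] at hk
      exact zero_ne_one hk
    have hsq : IsSquare k := by
      rw [← quadraticChar_one_iff_isSquare hk0]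
      rcases quadraticChar_dichotomy hk0 with h | h
      · exact h
      · rw [hχ, MulChar.ringHomComp_apply, h] at hk
        exfalso
        simp only [Int.reduceNeg, map_neg, map_one] at hk
        exact h2 (by linear_combination -hk)
    obtain ⟨a, rfl⟩ := exists_pow_of_isSquare hord hsq hk0
    have hpow := congrArg (· ^ 9 ^ a) hc
    have h9 : (9 : ℕ) ^ a = 3 ^ (2 * a) := by rw [pow_mul]; norm_num
    have hodd : Odd (9 ^ a) := Odd.pow (by decide)
    simp only [zero_pow hodd.pos.ne'] at hpow
    -- Raising to the power `9 ^ a` is additive in characteristic 3 and fixes the coefficients in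
    -- GF(9), so the zero moves to its conjugate.
    rw [h9, sum_pow_char_pow] at hpow
    rw [fourierSum, ← (finEquivZMod ρ).sum_comp, ← hpow]
    refine Finset.sum_congr rfl fun i _ => ?_
    have hψi : ψ (((9 ^ a : ℕ) : ZMod ρ) * finEquivZMod ρ i) = δ ^ (9 ^ a * (i : ℕ)) := by
      rw [hψdef, ← AddChar.zmodChar_apply' hδρ]
      push_cast
      rfl
    have hci : algebraMap E K (c i) ^ 9 ^ a = algebraMap E K (c i) := by
      rw [← map_pow, ← hE', FiniteField.pow_card_pow]
    have hδi : δ ^ (9 ^ a * (i : ℕ)) = (-1) ^ (i : ℕ) * (θ ^ (2 * (i : ℕ))) ^ 9 ^ a := by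
      rw [hδ, pow_mul, hodd.neg_pow, neg_pow]
      congr 1
      ring
    have h1 : ((-1 : K) ^ (i : ℕ)) * (-1) ^ (i : ℕ) = 1 := by
      rw [← mul_pow]; simp
    rw [hc'e, hψi, hδi, ← h9, Algebra.smul_def, mul_pow, hci]
    linear_combination algebraMap E K (c i) * (θ ^ (2 * (i : ℕ))) ^ 9 ^ a * h1
  have hsupp : ∀ i, c' (finEquivZMod ρ i) ≠ 0 ↔ c i ≠ 0 := fun i => by
    rw [hc'e]; simp
  have hc'0 : c' ≠ 0 := by
    obtain ⟨i, hi⟩ := Function.ne_iff.1 hc0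
    exact Function.ne_iff.2 ⟨_, (hsupp i).2 hi⟩
  have hbound := card_le_sq_of_fourierSum_eq_zero hχ2 hχn h2 hψ hF hvan hc'0
  rw [ZMod.card] at hbound
  refine hbound.trans_eq ?_
  rw [weight]
  congr 1
  refine (Finset.card_equiv (finEquivZMod ρ) fun i => ?_).symm
  simp only [Finset.mem_filter, Finset.mem_univ, true_and, hsupp]

end SquareRootBound

/-! ### Degree of the zero and dimension of the dual. -/

section Dimension

theorem four_mul_dvd_three_pow_sub_one {ρ : ℕ} (hρ : ρ.Prime) (hρ2 : ρ ≠ 2) (hρ3 : ρ ≠ 3) :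
    4 * ρ ∣ 3 ^ (ρ - 1) - 1 := by
  have : Fact ρ.Prime := ⟨hρ⟩
  have hcop : Nat.Coprime 4 ρ := by
    rw [show 4 = 2 ^ 2 from rfl]
    exact Nat.Coprime.pow_left 2 ((Nat.coprime_primes Nat.prime_two hρ).2 hρ2.symm)
  refine hcop.mul_dvd_of_dvd_of_dvd ?_ ?_
  · obtain ⟨k, hk⟩ := (hρ.odd_of_ne_two hρ2)
    rw [hk, Nat.add_sub_cancel, pow_mul]
    have h := Nat.sub_dvd_pow_sub_pow 9 1 k
    rw [one_pow] at h
    exact dvd_trans (by norm_num) h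
  · rw [← Nat.modEq_iff_dvd' (Nat.one_le_pow _ _ (by norm_num)), ← ZMod.natCast_eq_natCast_iff]
    have h3 : (3 : ZMod ρ) ≠ 0 := by
      intro h
      have := (ZMod.natCast_eq_zero_iff 3 ρ).1 (by exact_mod_cast h)
      exact hρ3 ((Nat.prime_dvd_prime_iff_eq hρ Nat.prime_three).1 this)
    push_cast
    exact (ZMod.pow_card_sub_one_eq_one h3).symm

/-- If `θ` generates a field of `3 ^ r` elements, then `ρ` divides `3 ^ r - 1`, so the order of 3
forces `r ≥ ρ - 1`. -/
theorem natDegree_minpoly_of_isPrimitiveRoot {ρ : ℕ} (hρ : ρ.Prime) {K : Type*} [Field K]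
    [Finite K] [Algebra (ZMod 3) K] (hfin : Module.finrank (ZMod 3) K = ρ - 1)
    (hord : orderOf (3 : ZMod ρ) = ρ - 1) {θ : K} (hθ : IsPrimitiveRoot θ (4 * ρ)) :
    (minpoly (ZMod 3) θ).natDegree = ρ - 1 := by
  have : Fact (Nat.Prime 3) := ⟨Nat.prime_three⟩
  have : FiniteDimensional (ZMod 3) K := Module.Finite.of_finite
  rw [← IntermediateField.adjoin.finrank (Algebra.IsIntegral.isIntegral θ)]
  set L := IntermediateField.adjoin (ZMod 3) {θ} with hL
  refine le_antisymm (hfin ▸ Submodule.finrank_le (Subalgebra.toSubmodule L.toSubalgebra)) ?_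
  have : Fintype L := Fintype.ofFinite L
  have hcard : Fintype.card L = 3 ^ Module.finrank (ZMod 3) L := by
    rw [Module.card_eq_pow_finrank (K := ZMod 3), ZMod.card]
  have hpow : θ ^ 3 ^ Module.finrank (ZMod 3) L = θ := by
    have h := FiniteField.pow_card (⟨θ, IntermediateField.mem_adjoin_simple_self _ θ⟩ : L)
    rw [hcard] at h
    exact congrArg Subtype.val h
  have hpos : 0 < Module.finrank (ZMod 3) L := Module.finrank_pos
  have h1 : 1 ≤ 3 ^ Module.finrank (ZMod 3) L := Nat.one_le_pow _ _ (by norm_num)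
  have hθ0 : θ ≠ 0 := by
    rintro rfl
    have h0 := hθ.pow_eq_one
    rw [zero_pow (by have := hρ.pos; omega)] at h0
    exact zero_ne_one h0
  have hpow' : θ ^ (3 ^ Module.finrank (ZMod 3) L - 1) = 1 := by
    refine mul_right_cancel₀ hθ0 ?_
    rw [← pow_succ, Nat.sub_add_cancel h1, hpow, one_mul]
  have hdvd : ρ ∣ 3 ^ Module.finrank (ZMod 3) L - 1 :=
    (Dvd.intro_left 4 rfl).trans (hθ.dvd_of_pow_eq_one _ hpow')
  rw [← Nat.modEq_iff_dvd' h1, ← ZMod.natCast_eq_natCast_iff] at hdvd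
  push_cast at hdvd
  rw [← hord]
  exact Nat.le_of_dvd hpos (orderOf_dvd_of_pow_eq_one hdvd.symm)

/-- The code is the kernel of evaluation at `θ`, which is onto because the powers of `θ` below its
degree already form a basis of `K`. -/
theorem finrank_of_mem_iff_vanishing {F K : Type*} [Field F] [Field K] [Algebra F K]
    [FiniteDimensional F K] {θ : K} (hθ : (minpoly F θ).natDegree = Module.finrank F K) {n : ℕ}
    (hn : Module.finrank F K ≤ n) {C : Submodule F (Fin n → F)}
    (hC : ∀ c, c ∈ C ↔ ∑ i, c i • θ ^ (i : ℕ) = 0) :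
    Module.finrank F C = n - Module.finrank F K := by
  set f : (Fin n → F) →ₗ[F] K := Fintype.linearCombination F fun i => θ ^ (i : ℕ) with hf
  have hker : C = LinearMap.ker f := by
    ext c
    rw [hC, LinearMap.mem_ker, hf, Fintype.linearCombination_apply]
  have hrange : LinearMap.range f = ⊤ := by
    rw [hf, Fintype.range_linearCombination, eq_top_iff,
      ← (linearIndependent_pow (K := F) θ).span_eq_top_of_card_eq_finrank' (by simp [hθ])]
    refine Submodule.span_mono ?_
    rintro _ ⟨i, rfl⟩
    exact ⟨⟨i, by omega⟩, rfl⟩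
  have h := LinearMap.finrank_range_add_finrank_ker f
  rw [hrange, finrank_top, Module.finrank_fin_fun, ← hker] at h
  omega

end Dimension

end NegacyclicCode
-- Assembly of the main theorem.
open NegacyclicCode in

theorem mainTheorem2 (ρ : ℕ) (hρ : ρ.Prime) (hmod : ρ % 12 = 5 ∨ ρ % 12 = 7)
    (hord : orderOf (3 : ZMod ρ) = ρ - 1)
    {E K : Type*} [Field E] [Field K] [Algebra (ZMod 3) K] [Algebra E K]
    (hE : Nat.card E = 3 ^ 2) (hK : Nat.card K = 3 ^ (ρ - 1))
    (α : K) (hα : IsPrimitiveRoot α (3 ^ (ρ - 1) - 1)) :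
    NegacyclicCode.IsNegacyclic (NegacyclicCode.dualCode (NegacyclicCode.ternaryCode ρ α)) ∧
    Module.finrank (ZMod 3) (NegacyclicCode.dualCode (NegacyclicCode.ternaryCode ρ α)) = ρ + 1 ∧
    NegacyclicCode.minDist (NegacyclicCode.dualCode (NegacyclicCode.nonaryCode E ρ α)) ≤
      NegacyclicCode.minDist (NegacyclicCode.dualCode (NegacyclicCode.ternaryCode ρ α)) ∧
    Real.sqrt (ρ : ℝ) ≤
      (NegacyclicCode.minDist (NegacyclicCode.dualCode (NegacyclicCode.nonaryCode E ρ α)) : ℝ) := by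
  have hρ2 : ρ ≠ 2 := by omega
  have hρ3 : ρ ≠ 3 := by omega
  have hρ5 : 5 ≤ ρ := by omega
  have : Fact ρ.Prime := ⟨hρ⟩
  have : Fact (Nat.Prime 3) := ⟨Nat.prime_three⟩
  have hρodd : Odd ρ := hρ.odd_of_ne_two hρ2
  have : Finite E := Nat.finite_of_card_ne_zero (by rw [hE]; norm_num)
  have : Finite K := Nat.finite_of_card_ne_zero (by rw [hK]; positivity)
  have : Fintype E := Fintype.ofFinite E
  have : FiniteDimensional (ZMod 3) K := Module.Finite.of_finite
  have : FiniteDimensional E K := Module.Finite.of_finite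
  have : CharP K 3 := charP_of_injective_algebraMap (algebraMap (ZMod 3) K).injective 3
  have : CharP E 3 := (algebraMap E K).charP (algebraMap E K).injective 3
  have hfin : Module.finrank (ZMod 3) K = ρ - 1 := by
    have h := Module.natCard_eq_pow_finrank (K := ZMod 3) (V := K)
    rw [hK, Nat.card_zmod] at h
    exact (Nat.pow_right_injective (by norm_num : 2 ≤ 3) h).symm
  have hdvd := four_mul_dvd_three_pow_sub_one hρ hρ2 hρ3
  have hpos : 0 < 3 ^ (ρ - 1) - 1 :=
    Nat.sub_pos_of_lt (Nat.one_lt_pow (by omega) (by norm_num))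
  have hβ : IsPrimitiveRoot (beta ρ α) (4 * ρ) := by
    rw [beta]
    exact hα.pow hpos (Nat.div_mul_cancel hdvd).symm
  set β := beta ρ α
  have hθ : IsPrimitiveRoot β⁻¹ (4 * ρ) := hβ.inv
  have hneg : ∀ {ζ : K}, IsPrimitiveRoot ζ (4 * ρ) → ζ ^ (2 * ρ) = -1 := fun h =>
    (h.pow (by omega) (by ring : 4 * ρ = 2 * ρ * 2)).eq_neg_one_of_two_right
  have hC : ∀ c, c ∈ dualCode (ternaryCode ρ α) ↔ ∑ i, c i • β⁻¹ ^ (i : ℕ) = 0 :=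
    mem_dualCode_codeOfCheckPoly_minpoly (by omega) (hneg hβ)
  have hD : ∀ c, c ∈ dualCode (nonaryCode E ρ α) ↔ ∑ i, c i • β⁻¹ ^ (2 * (i : ℕ)) = 0 :=
    mem_dualCode_traceCode
  have hdim : Module.finrank (ZMod 3) (dualCode (ternaryCode ρ α)) = ρ + 1 := by
    rw [finrank_of_mem_iff_vanishing
      ((natDegree_minpoly_of_isPrimitiveRoot hρ hfin hord hθ).trans hfin.symm) (by omega) hC, hfin]
    omega
  obtain ⟨u, hu2, hu⟩ : ∃ u : E, u ^ 2 = -1 ∧ algebraMap E K u = β⁻¹ ^ ρ := by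
    obtain ⟨v, hv⟩ : IsSquare (-1 : E) := by
      rw [FiniteField.isSquare_neg_one_iff, ← Nat.card_eq_fintype_card, hE]
      norm_num
    have h : algebraMap E K v ^ 2 = (β⁻¹ ^ ρ) ^ 2 := by
      rw [← map_pow, sq v, ← hv, map_neg, map_one, ← pow_mul, mul_comm ρ 2, hneg hθ]
    rcases sq_eq_sq_iff_eq_or_eq_neg.1 h with h | h
    · exact ⟨v, by rw [sq, ← hv], h⟩
    · exact ⟨-v, by rw [neg_sq, sq, ← hv], by rw [map_neg, h, neg_neg]⟩
  have hpair : ∀ c ∈ dualCode (ternaryCode ρ α), c ≠ 0 →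
      ∃ e ∈ dualCode (nonaryCode E ρ α), e ≠ 0 ∧ weight e ≤ weight c := fun c hc hc0 => by
    obtain ⟨e, he0, he, hle⟩ := exists_weight_le_of_vanishing hρodd
      (ZMod.castHom (dvd_refl 3) E) hu hu2 hc0 ((hC c).1 hc)
    exact ⟨e, (hD e).2 he, he0, hle⟩
  -- `minDist` is `0` on the zero code, so both duals must contain a nonzero word; the dimension
  -- supplies one and `hpair` carries it over.
  have hCne : ∃ c ∈ dualCode (ternaryCode ρ α), c ≠ 0 := by
    refine (Submodule.ne_bot_iff _).1 fun h => ?_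
    rw [h, finrank_bot] at hdim
    omega
  obtain ⟨c, hc, hc0, hcw⟩ := exists_weight_eq_minDist hCne
  obtain ⟨e, he, he0, hew⟩ := hpair c hc hc0
  obtain ⟨f, hf, hf0, hfw⟩ := exists_weight_eq_minDist ⟨e, he, he0⟩
  refine ⟨isNegacyclic_of_mem_iff (hneg hθ) hC, hdim, ?_, ?_⟩
  · rw [← hcw]
    exact (minDist_le_weight he he0).trans hew
  · rw [← hfw]
    refine (Real.sqrt_le_left (Nat.cast_nonneg _)).2 ?_
    exact_mod_cast le_weight_sq_of_vanishing hρ2 hρ3 hord hE hθ hf0 ((hD f).1 hf)
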